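/- All graphs are finite and simple. A chordless cycle of a graph $G$ is a cycle (with at least three vertices) that occurs as an induced subgraph of $G$. An orientation of $G$, i.e. a choice of an ordering of the two endpoints of every edge, is called cyclic if its restriction to every chordless cycle $v_1, v_2, \dots, v_k, v_1$ of $G$ is either $(v_1,v_2), \dots, (v_{k-1},v_k), (v_k,v_1)$ or the opposite of this orientation. The graph $G$ is called cyclically orientable if it has a cyclic orientation. **Proposition.** Let $G$ be a cyclically orientable graph with $n \ge 2$ vertices. Then $G$ has at most $2n-3$ edges. -/

import Mathlib

namespace SimpleGraph

/-- An orientation of a graph `G`: for every edge of `G`, a choice of one of the two orderings of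
its endpoints. `O.Arc u v` says that the edge `{u, v}` is ordered as `(u, v)`. -/
structure EdgeOrientation {V : Type*} (G : SimpleGraph V) where
  Arc : V → V → Prop
  adj_iff : ∀ u v : V, G.Adj u v ↔ Arc u v ∨ Arc v u
  asymm : ∀ u v : V, Arc u v → ¬ Arc v u

/-- A closed walk `p` running once around a cycle is cyclically oriented by `O` if all of its edges
are oriented in the direction in which `p` runs, or all of them in the opposite direction. -/
def EdgeOrientation.OrientsCyclically {V : Type*} {G : SimpleGraph V} (O : G.EdgeOrientation)
    {v : V} (p : G.Walk v v) : Prop :=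
  (∀ d ∈ p.darts, O.Arc d.fst d.snd) ∨ (∀ d ∈ p.darts, O.Arc d.snd d.fst)

/-- An orientation is cyclic if its restriction to every chordless cycle (a cycle that occurs as
an induced subgraph) is cyclic. -/
def EdgeOrientation.IsCyclic {V : Type*} {G : SimpleGraph V} (O : G.EdgeOrientation) : Prop :=
  ∀ (v : V) (p : G.Walk v v), p.IsCycle → p.toSubgraph.IsInduced → O.OrientsCyclically p

/-- A graph is cyclically orientable if it has a cyclic orientation. -/
def CyclicallyOrientable {V : Type*} (G : SimpleGraph V) : Prop :=
  ∃ O : G.EdgeOrientation, O.IsCyclic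

end SimpleGraph

namespace SimpleGraph

variable {V : Type*} {G : SimpleGraph V}

/-! Induction on vertex sets `S` bounds the edges inside `S` by `2|S| - 3`. On a cyclically oriented
chordless cycle through `v`, one edge enters `v` and one leaves, so no three edges at `v` can
pairwise lie on such cycles (`arc_iff_not_arc`). If `S` is not a clique, take a largest connected `C
⊆ S` with some `v ∈ S` outside `C` and not adjacent to it, and let `A` be the neighbourhood of `C`
in `S`. Maximality makes `v` adjacent to all of `A`. Either `|A| ≤ 1` and `A` separates `C` from
`v`, or cycles through `C` and triangles force `v` to have at most two neighbours in `S`. -/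

/-- Among the walks from `x` to `y` whose support satisfies `P`, one of minimal length is a path,
and any two adjacent vertices on it are consecutive. -/
theorem Walk.exists_chordless_path {x y : V} (P : V → Prop) (p : G.Walk x y)
    (hp : ∀ z ∈ p.support, P z) :
    ∃ q : G.Walk x y, q.IsPath ∧ (∀ z ∈ q.support, P z) ∧
      ∀ a ∈ q.support, ∀ b ∈ q.support, G.Adj a b → q.toSubgraph.Adj a b := by
  classical
  have hex : ∃ n, ∃ q : G.Walk x y, (∀ z ∈ q.support, P z) ∧ q.length = n := ⟨_, p, hp, rfl⟩
  obtain ⟨q₀, hq₀, hlen₀⟩ := Nat.find_spec hex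
  have hmin : ∀ r : G.Walk x y, (∀ z ∈ r.support, P z) → Nat.find hex ≤ r.length :=
    fun r hr => Nat.find_min' hex ⟨r, hr, rfl⟩
  have hqP : ∀ z ∈ q₀.bypass.support, P z := fun z hz => hq₀ z (q₀.support_bypass_subset_support hz)
  have hqlen : q₀.bypass.length ≤ Nat.find hex := hlen₀ ▸ q₀.length_bypass_le_length
  refine ⟨q₀.bypass, q₀.bypass_isPath, hqP, ?_⟩
  generalize q₀.bypass = q at hqP hqlen
  have key : ∀ i j, i ≤ j → j ≤ q.length → G.Adj (q.getVert i) (q.getVert j) →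
      q.toSubgraph.Adj (q.getVert i) (q.getVert j) := by
    intro i j hij hj hadj
    have hne : i ≠ j := by rintro rfl; exact G.loopless.irrefl _ hadj
    -- Shortcut the walk along the chord; minimality of the length then forces `j ≤ i + 1`.
    have hshort := hmin ((q.take i).append (Walk.cons hadj (q.drop j))) (by
      intro z hz
      rw [Walk.mem_support_append_iff, Walk.support_cons, List.mem_cons] at hz
      rcases hz with hz | rfl | hz
      · exact hqP z ((q.isSubwalk_take i).support_subset hz)
      · exact hqP _ (q.getVert_mem_support i)
      · exact hqP z ((q.isSubwalk_drop j).support_subset hz))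
    rw [Walk.length_append, Walk.length_cons, Walk.take_length, Walk.drop_length] at hshort
    obtain rfl : j = i + 1 := by omega
    exact q.toSubgraph_adj_getVert (by omega)
  intro a ha b hb hab
  obtain ⟨i, rfl, hi⟩ := Walk.mem_support_iff_exists_getVert.mp ha
  obtain ⟨j, rfl, hj⟩ := Walk.mem_support_iff_exists_getVert.mp hb
  rcases le_total i j with hij | hij
  · exact key i j hij hj hab
  · exact (key j i hij hi hab.symm).symm

/-- In a cyclic orientation, if two neighbours `x ≠ y` of `v` are joined by a walk whose inner
vertices avoid `v` and its neighbours, then exactly one of the edges `{v, x}`, `{v, y}` leaves `v`. -/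
theorem EdgeOrientation.IsCyclic.arc_iff_not_arc {O : G.EdgeOrientation} (hO : O.IsCyclic)
    {v x y : V} (hxy : x ≠ y) (hx : G.Adj v x) (hy : G.Adj v y) (p : G.Walk x y)
    (hp : ∀ z ∈ p.support, z ≠ v ∧ (G.Adj v z → z = x ∨ z = y)) :
    O.Arc v x ↔ ¬ O.Arc v y := by
  obtain ⟨q, hq, hqP, hqi⟩ := p.exists_chordless_path _ hp
  have hv : v ∉ q.support := fun h => (hqP v h).1 rfl
  let c : G.Walk v v := Walk.cons hx (q.concat hy.symm)
  have hc : c.IsCycle := by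
    refine (Walk.cons_isCycle_iff _ _).mpr ⟨hq.concat hv hy.symm, ?_⟩
    rw [Walk.edges_concat, List.concat_eq_append, List.mem_append, List.mem_singleton]
    rintro (h | h)
    · exact hv (q.fst_mem_support_of_mem_edges h)
    · rw [Sym2.eq_iff] at h
      rcases h with ⟨h, -⟩ | ⟨-, h⟩
      · exact hy.ne h
      · exact hxy h
  have hadj : ∀ {a b : V}, s(a, b) ∈ c.edges → c.toSubgraph.Adj a b := fun h =>
    Walk.mem_edges_toSubgraph _ |>.mpr h
  have hce : c.edges = s(v, x) :: (q.edges ++ [s(y, v)]) := by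
    simp [c, Walk.edges_concat]
  have hcv : ∀ b ∈ q.support, G.Adj v b → c.toSubgraph.Adj v b := by
    intro b hb hvb
    rcases (hqP b hb).2 hvb with rfl | rfl
    · exact hadj (by simp [hce])
    · exact hadj (by simp [hce, Sym2.eq_swap])
  have hi : c.toSubgraph.IsInduced := by
    have hs : ∀ {a}, a ∈ c.toSubgraph.verts → a = v ∨ a ∈ q.support := by
      intro a ha
      rw [Walk.mem_verts_toSubgraph] at ha
      simpa [c, Walk.support_concat, or_comm, or_assoc] using ha
    intro a ha b hb hab
    rcases hs ha with rfl | ha' <;> rcases hs hb with rfl | hb'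
    · exact (G.loopless.irrefl _ hab).elim
    · exact hcv b hb' hab
    · exact (hcv a ha' hab.symm).symm
    · refine hadj ?_
      rw [hce]
      have := (Walk.mem_edges_toSubgraph q).mp (Subgraph.mem_edgeSet.mpr (hqi a ha' b hb' hab))
      simp [this]
  -- The cycle leaves `v` towards `x` and returns from `y`.
  have hd₁ : (⟨(v, x), hx⟩ : G.Dart) ∈ c.darts := by simp [c]
  have hd₂ : (⟨(y, v), hy.symm⟩ : G.Dart) ∈ c.darts := by simp [c, Walk.darts_concat]
  rcases hO v c hc hi with h | h
  · exact iff_of_true (h _ hd₁) (O.asymm _ _ (h _ hd₂))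
  · exact iff_of_false (O.asymm _ _ (h _ hd₁)) (not_not_intro (h _ hd₂))

/-- Any two vertices of `C` are joined by a walk inside `C`. -/
def ConnectedWithin (G : SimpleGraph V) (C : Finset V) : Prop :=
  ∀ a ∈ C, ∀ b ∈ C, ∃ p : G.Walk a b, ∀ z ∈ p.support, z ∈ C

theorem connectedWithin_singleton (u : V) : G.ConnectedWithin {u} := by
  intro a ha b hb
  rw [Finset.mem_singleton] at ha hb
  subst ha hb
  exact ⟨Walk.nil, by simp⟩

theorem ConnectedWithin.insert [DecidableEq V] {C : Finset V} (hC : G.ConnectedWithin C) {a c : V}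
    (hc : c ∈ C) (hac : G.Adj a c) : G.ConnectedWithin (insert a C) := by
  have key : ∀ b ∈ C, ∃ p : G.Walk a b, ∀ z ∈ p.support, z ∈ Insert.insert a C := by
    intro b hb
    obtain ⟨p, hp⟩ := hC c hc b hb
    refine ⟨Walk.cons hac p, fun z hz => ?_⟩
    rw [Walk.support_cons, List.mem_cons] at hz
    exact Finset.mem_insert.mpr (hz.imp_right (hp z))
  intro b hb d hd
  rcases Finset.mem_insert.mp hb with rfl | hb' <;> rcases Finset.mem_insert.mp hd with rfl | hd'
  · exact ⟨Walk.nil, by simp⟩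
  · exact key d hd'
  · obtain ⟨p, hp⟩ := key b hb'
    exact ⟨p.reverse, by simpa using hp⟩
  · obtain ⟨p, hp⟩ := hC b hb' d hd'
    exact ⟨p, fun z hz => Finset.mem_insert_of_mem (hp z hz)⟩

open Classical in
/-- The edges of `G` with both endpoints in `S`. -/
noncomputable def edgesWithin (G : SimpleGraph V) [Fintype G.edgeSet] (S : Finset V) :
    Finset (Sym2 V) :=
  G.edgeFinset.filter fun e => ∀ v ∈ e, v ∈ S

theorem mk_mem_edgesWithin [Fintype G.edgeSet] {S : Finset V} {u v : V} :
    s(u, v) ∈ G.edgesWithin S ↔ G.Adj u v ∧ u ∈ S ∧ v ∈ S := by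
  simp [edgesWithin]

theorem card_edgesWithin_le_add [Fintype G.edgeSet] {S S₁ S₂ : Finset V}
    (h : ∀ u ∈ S, ∀ v ∈ S, G.Adj u v → (u ∈ S₁ ∧ v ∈ S₁) ∨ (u ∈ S₂ ∧ v ∈ S₂)) :
    (G.edgesWithin S).card ≤ (G.edgesWithin S₁).card + (G.edgesWithin S₂).card := by
  classical
  refine (Finset.card_le_card fun e he => ?_).trans (Finset.card_union_le _ _)
  induction e with | _ u v =>
  obtain ⟨huv, hu, hv⟩ := mk_mem_edgesWithin.mp he
  rw [Finset.mem_union, mk_mem_edgesWithin, mk_mem_edgesWithin]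
  exact (h u hu v hv huv).imp (fun h => ⟨huv, h⟩) fun h => ⟨huv, h⟩

theorem card_edgesWithin_le_erase_add [DecidableEq V] [Fintype G.edgeSet] {S T : Finset V} {v : V}
    (h : ∀ u ∈ S, G.Adj v u → u ∈ T) :
    (G.edgesWithin S).card ≤ (G.edgesWithin (S.erase v)).card + T.card := by
  have hsub : G.edgesWithin S ⊆ G.edgesWithin (S.erase v) ∪ T.image fun u => s(v, u) := by
    intro e he
    induction e with | _ a b =>
    obtain ⟨hab, ha, hb⟩ := mk_mem_edgesWithin.mp he
    rw [Finset.mem_union, mk_mem_edgesWithin, Finset.mem_image]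
    by_cases hav : a = v
    · subst hav
      exact Or.inr ⟨b, h b hb hab, rfl⟩
    by_cases hbv : b = v
    · subst hbv
      exact Or.inr ⟨a, h a ha hab.symm, Sym2.eq_swap⟩
    exact Or.inl ⟨hab, Finset.mem_erase.mpr ⟨hav, ha⟩, Finset.mem_erase.mpr ⟨hbv, hb⟩⟩
  calc (G.edgesWithin S).card ≤ _ := Finset.card_le_card hsub
    _ ≤ _ := Finset.card_union_le _ _
    _ ≤ _ := Nat.add_le_add_left Finset.card_image_le _

theorem card_edgesWithin_of_card_eq_one [Fintype G.edgeSet] {S : Finset V} (hS : S.card = 1) :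
    (G.edgesWithin S).card = 0 := by
  obtain ⟨a, rfl⟩ := Finset.card_eq_one.mp hS
  rw [Finset.card_eq_zero, Finset.eq_empty_iff_forall_notMem]
  intro e he
  induction e with | _ u v =>
  obtain ⟨huv, hu, hv⟩ := mk_mem_edgesWithin.mp he
  rw [Finset.mem_singleton] at hu hv
  exact huv.ne (hu.trans hv.symm)

theorem card_edgesWithin_of_card_eq_two [Fintype G.edgeSet] {S : Finset V} (hS : S.card = 2) :
    (G.edgesWithin S).card ≤ 1 := by
  classical
  obtain ⟨a, b, hab, rfl⟩ := Finset.card_eq_two.mp hS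
  have h := card_edgesWithin_le_erase_add (G := G) (S := {a, b}) (T := {b}) (v := a) (by
    intro u hu hau
    rcases Finset.mem_insert.mp hu with rfl | hu
    · exact (G.loopless.irrefl _ hau).elim
    · exact hu)
  have hcard := Finset.card_erase_of_mem (Finset.mem_insert_self a {b})
  rw [card_edgesWithin_of_card_eq_one (S := Finset.erase {a, b} a) (by omega),
    Finset.card_singleton] at h
  exact h

/-- In a cyclically oriented graph, every nonempty set `S` of vertices either is disconnected by
removing at most one vertex, or contains a vertex with at most two neighbours inside `S`. -/
theorem EdgeOrientation.IsCyclic.exists_cut_or_exists_neighbors_subset [DecidableEq V]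
    {O : G.EdgeOrientation} (hO : O.IsCyclic) {S : Finset V} (hS : S.Nonempty) :
    (∃ C A R : Finset V, C.Nonempty ∧ R.Nonempty ∧ A.card ≤ 1 ∧ C ∪ A ∪ R = S ∧
        Disjoint C A ∧ Disjoint (C ∪ A) R ∧ ∀ c ∈ C, ∀ r ∈ R, ¬ G.Adj c r) ∨
      ∃ v ∈ S, ∃ T : Finset V, T.card ≤ 2 ∧ ∀ u ∈ S, G.Adj v u → u ∈ T := by
  classical
  have triangle : ∀ {v x y : V}, G.Adj v x → G.Adj v y → G.Adj x y →
      (O.Arc v x ↔ ¬ O.Arc v y) := fun {v x y} hx hy hxy =>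
    hO.arc_iff_not_arc hxy.ne hx hy hxy.toWalk (by
      intro z hz
      have hz' : z = x ∨ z = y := by simpa using hz
      refine ⟨?_, fun _ => hz'⟩
      rcases hz' with rfl | rfl
      · exact hx.ne'
      · exact hy.ne')
  let Far (v : V) (C : Finset V) : Prop := ∀ c ∈ C, c ≠ v ∧ ¬ G.Adj v c
  let F : Finset (Finset V) := S.powerset.filter fun C =>
    C.Nonempty ∧ G.ConnectedWithin C ∧ ∃ v ∈ S, Far v C
  rcases F.eq_empty_or_nonempty with hF | hF
  · right
    have hcomplete : ∀ u ∈ S, ∀ v ∈ S, u ≠ v → G.Adj v u := by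
      intro u hu v hv huv
      by_contra hadj
      have : ({u} : Finset V) ∈ F := Finset.mem_filter.mpr
        ⟨Finset.mem_powerset.mpr (Finset.singleton_subset_iff.mpr hu), Finset.singleton_nonempty u,
          connectedWithin_singleton u, v, hv, by simp [Far, huv, hadj]⟩
      simp [hF] at this
    obtain ⟨v, hv⟩ := hS
    refine ⟨v, hv, S.erase v, ?_, fun u hu huv => Finset.mem_erase.mpr ⟨huv.ne', hu⟩⟩
    by_contra! hcard
    obtain ⟨a, b, c, ha, hb, hc, hab, hac, hbc⟩ := Finset.two_lt_card_iff.mp hcard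
    rw [Finset.mem_erase] at ha hb hc
    have h₁ := triangle (hcomplete a ha.2 v hv ha.1) (hcomplete b hb.2 v hv hb.1)
      (hcomplete b hb.2 a ha.2 hab.symm)
    have h₂ := triangle (hcomplete a ha.2 v hv ha.1) (hcomplete c hc.2 v hv hc.1)
      (hcomplete c hc.2 a ha.2 hac.symm)
    have h₃ := triangle (hcomplete b hb.2 v hv hb.1) (hcomplete c hc.2 v hv hc.1)
      (hcomplete c hc.2 b hb.2 hbc.symm)
    -- Three truth values cannot be pairwise opposite.
    tauto
  obtain ⟨C, hCF, hmax⟩ := F.exists_max_image Finset.card hF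
  obtain ⟨hCS, hCne, hCconn, v, hv, hvC⟩ := Finset.mem_filter.mp hCF
  rw [Finset.mem_powerset] at hCS
  let A : Finset V := S.filter fun a => a ∉ C ∧ ∃ c ∈ C, G.Adj a c
  have hA : ∀ {a}, a ∈ A ↔ a ∈ S ∧ a ∉ C ∧ ∃ c ∈ C, G.Adj a c := fun {a} => Finset.mem_filter
  have hAadj : ∀ w ∈ S, Far w C → ∀ a ∈ A, G.Adj w a := by
    intro w hw hwC a haA
    obtain ⟨ha, haC, c, hc, hac⟩ := hA.mp haA
    by_contra hwa
    have haw : a ≠ w := by rintro rfl; exact (hwC c hc).2 hac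
    -- If `w` missed `a`, the larger connected set `insert a C` would still be far from `w`.
    have hmem : insert a C ∈ F := Finset.mem_filter.mpr
      ⟨Finset.mem_powerset.mpr (Finset.insert_subset ha hCS), Finset.insert_nonempty _ _,
        hCconn.insert hc hac, w, hw, by
          intro z hz
          rcases Finset.mem_insert.mp hz with rfl | hz
          · exact ⟨haw, hwa⟩
          · exact hwC z hz⟩
    have := hmax _ hmem
    rw [Finset.card_insert_of_notMem haC] at this
    omega
  have hfar : ∀ w ∈ S, w ∉ C → w ∉ A → Far w C := by
    intro w hw hwC hwA c hc
    exact ⟨fun h => hwC (h ▸ hc), fun h => hwA (hA.mpr ⟨hw, hwC, c, hc, h⟩)⟩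
  have hvC' : v ∉ C := fun h => (hvC v h).1 rfl
  have hvA : v ∉ A := fun h => by
    obtain ⟨-, -, c, hc, h⟩ := hA.mp h
    exact (hvC c hc).2 h
  rcases le_or_gt A.card 1 with hA1 | hA2
  · left
    have hCA : C ∪ A ⊆ S := Finset.union_subset hCS (Finset.filter_subset _ _)
    refine ⟨C, A, S \ (C ∪ A), hCne, ⟨v, by simp [hv, hvC', hvA]⟩, hA1,
      Finset.union_sdiff_of_subset hCA, ?_, Finset.disjoint_sdiff, ?_⟩
    · exact Finset.disjoint_left.mpr fun c hc hcA => (hA.mp hcA).2.1 hc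
    · intro c hc r hr hcr
      simp only [Finset.mem_sdiff, Finset.mem_union, not_or] at hr
      exact (hfar r hr.1 hr.2.1 hr.2.2 c hc).2 hcr.symm
  · right
    have hArel : ∀ {x y : V}, x ∈ A → y ∈ A → x ≠ y → (O.Arc v x ↔ ¬ O.Arc v y) := by
      intro x y hx hy hxy
      obtain ⟨-, -, c, hc, hxc⟩ := hA.mp hx
      obtain ⟨-, -, d, hd, hyd⟩ := hA.mp hy
      obtain ⟨p, hp⟩ := hCconn c hc d hd
      have hvx := hAadj v hv hvC x hx
      have hvy := hAadj v hv hvC y hy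
      refine hO.arc_iff_not_arc hxy hvx hvy ((Walk.cons hxc p).concat hyd.symm) ?_
      intro z hz
      have hz' : z = x ∨ z ∈ p.support ∨ z = y := by
        simpa [Walk.support_concat, or_assoc] using hz
      rcases hz' with rfl | hz | rfl
      · exact ⟨hvx.ne', fun _ => Or.inl rfl⟩
      · exact ⟨(hvC z (hp z hz)).1, fun h => ((hvC z (hp z hz)).2 h).elim⟩
      · exact ⟨hvy.ne', fun _ => Or.inr rfl⟩
    have hrel : ∀ {w x : V}, w ∈ S → G.Adj v w → x ∈ A → w ≠ x → (O.Arc v w ↔ ¬ O.Arc v x) := by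
      intro w x hw hvw hx hwx
      by_cases hwA : w ∈ A
      · exact hArel hwA hx hwx
      -- Here `w` is itself far from `C`, hence adjacent to `x`, and `v`, `w`, `x` form a triangle.
      · have hwC : w ∉ C := fun h => (hvC w h).2 hvw
        exact triangle hvw (hAadj v hv hvC x hx) (hAadj w hw (hfar w hw hwC hwA) x hx)
    obtain ⟨a, ha, b, hb, hab⟩ := Finset.one_lt_card.mp hA2
    refine ⟨v, hv, {a, b}, Finset.card_le_two, fun w hw hvw => ?_⟩
    by_contra hmem
    simp only [Finset.mem_insert, Finset.mem_singleton, not_or] at hmem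
    have h₁ := hArel ha hb hab
    have h₂ := hrel hw hvw ha hmem.1
    have h₃ := hrel hw hvw hb hmem.2
    tauto

theorem EdgeOrientation.IsCyclic.card_edgesWithin_add_three_le [Fintype G.edgeSet]
    {O : G.EdgeOrientation} (hO : O.IsCyclic) (S : Finset V) (hS : 2 ≤ S.card) :
    (G.edgesWithin S).card + 3 ≤ 2 * S.card := by
  classical
  induction S using Finset.strongInduction with | H S ih =>
  rcases hS.eq_or_lt with hS2 | hS3
  · have := card_edgesWithin_of_card_eq_two (G := G) hS2.symm
    omega
  rcases hO.exists_cut_or_exists_neighbors_subset (Finset.card_pos.mp (by omega : 0 < S.card)) with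
    ⟨C, A, R, hC, hR, hA, rfl, hCA, hCAR, hCR⟩ | ⟨v, hv, T, hT, hvT⟩
  · have hsplit := card_edgesWithin_le_add (G := G) (S := C ∪ A ∪ R) (S₁ := C ∪ A) (S₂ := A ∪ R) (by
      intro u hu w hw huw
      have h₁ : u ∈ C → w ∉ R := fun hu hw => hCR u hu w hw huw
      have h₂ : w ∈ C → u ∉ R := fun hw hu => hCR w hw u hu huw.symm
      simp only [Finset.mem_union] at hu hw ⊢
      tauto)
    have hAR : Disjoint A R := hCAR.mono_left Finset.subset_union_right
    have hC0 := hC.card_pos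
    have hR0 := hR.card_pos
    have hcard : (C ∪ A ∪ R).card = C.card + A.card + R.card := by
      rw [Finset.card_union_of_disjoint hCAR, Finset.card_union_of_disjoint hCA]
    have hcard₁ := Finset.card_union_of_disjoint hCA
    have hcard₂ := Finset.card_union_of_disjoint hAR
    -- A one-vertex piece has no edges and only satisfies the weaker bound `2|B| - 2`.
    have bound : ∀ B ⊂ C ∪ A ∪ R, 1 ≤ B.card →
        (G.edgesWithin B).card + 2 ≤ 2 * B.card ∧
        (2 ≤ B.card → (G.edgesWithin B).card + 3 ≤ 2 * B.card) := by
      intro B hB hB1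
      refine ⟨?_, ih B hB⟩
      rcases hB1.eq_or_lt with h | h
      · have := card_edgesWithin_of_card_eq_one (G := G) h.symm
        omega
      · have := ih B hB h
        omega
    have hss : ∀ B ⊆ C ∪ A ∪ R, B.card < (C ∪ A ∪ R).card → B ⊂ C ∪ A ∪ R := fun B hB hlt =>
      hB.ssubset_of_ne fun h => hlt.ne (congrArg Finset.card h)
    have b₁ := bound (C ∪ A) (hss _ Finset.subset_union_left (by omega)) (by omega)
    have b₂ := bound (A ∪ R) (hss _
      (Finset.union_subset_union_left Finset.subset_union_right) (by omega)) (by omega)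
    -- For empty `A` the weak bounds suffice. A single cut vertex is counted twice, but then both
    -- pieces have at least two vertices and obey the strong bound. Either way the total is at most
    -- `2|S| - 4`.
    rcases Nat.eq_zero_or_pos A.card with hA0 | hA0
    · omega
    · have := b₁.2 (by omega)
      have := b₂.2 (by omega)
      omega
  · have h := card_edgesWithin_le_erase_add (G := G) hvT
    have hcard := Finset.card_erase_of_mem hv
    have := ih (S.erase v) (Finset.erase_ssubset hv) (by omega)
    omega

end SimpleGraph

theorem mainTheorem4 {V : Type*} [Fintype V] (G : SimpleGraph V) [Fintype G.edgeSet]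
    (hV : 2 ≤ Fintype.card V) (hG : G.CyclicallyOrientable) :
    (G.edgeFinset.card : ℤ) ≤ 2 * (Fintype.card V : ℤ) - 3 := by
  obtain ⟨O, hO⟩ := hG
  have h := hO.card_edgesWithin_add_three_le Finset.univ hV
  have huniv : G.edgesWithin Finset.univ = G.edgeFinset := by simp [SimpleGraph.edgesWithin]
  rw [huniv, Finset.card_univ] at h
  omega
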